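/- Let $\ell\ge 1$ be an integer. For elements $x_1,\dots,x_\ell$ of a group $G$ put $[x,y]=x^{-1}y^{-1}xy$ and $[x_1,\dots,x_\ell]=[\dots[[x_1,x_2],x_3],\dots,x_\ell]$ (so $[x_1]=x_1$ when $\ell=1$); such an element is called a commutator of length $\ell$. Let $\mathcal D_\ell(G)$ be the set of commutators of length $\ell$ of $G$ whose order is maximal among the orders of all commutators of length $\ell$ of $G$, where an infinite order counts as larger than every finite order. Write $\gamma_\ell(G)$ for the $\ell$-th term of the lower central series of $G$ (so $\gamma_1(G)=G$ and $\gamma_{i+1}(G)=[\gamma_i(G),G]$). Theorem. Let $G$ be a residually finite group such that the maximal order is attained, i.e. $\mathcal D_\ell(G)\neq\emptyset$, and such that $\mathcal D_\ell(G)$ is finite. Then $G$ contains a subgroup $M$ of finite index such that $\gamma_\ell(M)=1$. Moreover, if $G$ is finitely generated, then $\gamma_\ell(G)$ is finite. -/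

import Mathlib

/-- The commutator `[x, y] = x⁻¹ y⁻¹ x y`. -/
def elemCommutator {G : Type*} [Group G] (x y : G) : G :=
  x⁻¹ * y⁻¹ * x * y

/-- The left-normed commutator `[x₁, x₂, …, x_k] = [… [[x₁, x₂], x₃], …, x_k]`,
where `x = x₁` and `xs = [x₂, …, x_k]`. For `xs = []` it is `x₁` itself. -/
def leftNormedCommutator {G : Type*} [Group G] (x : G) (xs : List G) : G :=
  xs.foldl elemCommutator x

/-- The set of commutators of length `l`, that is, of all `[x₁, …, x_l]` with `x₁, …, x_l ∈ G`. -/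
def commutatorsOfLength (G : Type*) [Group G] (l : ℕ) : Set G :=
  {c | ∃ (x : G) (xs : List G), xs.length + 1 = l ∧ leftNormedCommutator x xs = c}

/-- The order of a group element, equal to `⊤` if the element has infinite order. -/
noncomputable def elemOrder {G : Type*} [Group G] (g : G) : ℕ∞ :=
  ENat.card (Subgroup.zpowers g)

/-- The set of commutators of length `l` whose order is maximal among all commutators
of length `l` of `G`. An infinite order is larger than every finite one. -/
def maxOrderCommutators (G : Type*) [Group G] (l : ℕ) : Set G :=
  {c | c ∈ commutatorsOfLength G l ∧ ∀ d ∈ commutatorsOfLength G l, elemOrder d ≤ elemOrder c}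

open scoped commutatorElement

/-! Write D for the set of commutators of length l of maximal order. It is finite and closed under
conjugation, so its centralizer has finite index.

The maximal order is finite: otherwise the commutators of infinite order form a nonempty finite
normal set. They generate a center-by-finite subgroup H. Modulo its torsion H is abelian and
torsion-free, and there power identities for commutators produce infinitely many commutators of
infinite order (`infiniteOrderCommutators_eq_empty`).

Fix c = [x₁, …, x_l] in D. Residual finiteness gives a normal M of finite index, centralizing D, so
small that every commutator with entries in the cosets xᵢM equals c. Removing the entries from the
right, this coset identity forces γ_l(M) = 1 (`lowerCentralSeries_eq_bot_of_coset_identity`).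

If G is finitely generated, so is M, and its torsion is finite. Hence some normal N ≤ M of finite
index is torsion-free. Commutators of length l starting in N are torsion, hence trivial, so N lies
in the upper central series and centralizes γ_l(G). Thus γ_l(G) is center-by-finite and generated by
torsion, hence torsion; it meets N trivially and embeds in G/N. -/

theorem elemCommutator_eq_mul {G : Type*} [Group G] (x y : G) :
    elemCommutator x y = (y * x)⁻¹ * (x * y) := by
  simp [elemCommutator, mul_assoc]

theorem map_elemCommutator {G H : Type*} [Group G] [Group H] (f : G →* H) (x y : G) :
    f (elemCommutator x y) = elemCommutator (f x) (f y) := by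
  simp [elemCommutator]

theorem commutatorElement_eq_elemCommutator_inv {G : Type*} [Group G] (x y : G) :
    ⁅x, y⁆ = elemCommutator x⁻¹ y⁻¹ := by
  simp [elemCommutator, commutatorElement_def]

theorem elemCommutator_mul_right {G : Type*} [Group G] (u x m : G) :
    elemCommutator u (x * m) = elemCommutator u m * (m⁻¹ * elemCommutator u x * m) := by
  simp only [elemCommutator]; group

theorem leftNormedCommutator_append {G : Type*} [Group G] (x : G) (xs ys : List G) :
    leftNormedCommutator x (xs ++ ys) = leftNormedCommutator (leftNormedCommutator x xs) ys :=
  List.foldl_append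

theorem leftNormedCommutator_concat {G : Type*} [Group G] (x : G) (xs : List G) (y : G) :
    leftNormedCommutator x (xs ++ [y]) = elemCommutator (leftNormedCommutator x xs) y :=
  leftNormedCommutator_append x xs [y]

theorem map_leftNormedCommutator {G H : Type*} [Group G] [Group H] (f : G →* H) (x : G)
    (xs : List G) :
    f (leftNormedCommutator x xs) = leftNormedCommutator (f x) (xs.map f) := by
  induction xs generalizing x with
  | nil => rfl
  | cons y ys ih =>
    change f (leftNormedCommutator (elemCommutator x y) ys) = _
    rw [ih, map_elemCommutator]
    rfl

theorem map_mem_commutatorsOfLength {G H : Type*} [Group G] [Group H] (f : G →* H) {l : ℕ}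
    {c : G} (hc : c ∈ commutatorsOfLength G l) : f c ∈ commutatorsOfLength H l := by
  obtain ⟨x, xs, hl, rfl⟩ := hc
  exact ⟨f x, xs.map f, by simpa using hl, (map_leftNormedCommutator f x xs).symm⟩

theorem exists_lift_mem_commutatorsOfLength {G H : Type*} [Group G] [Group H] (f : G →* H)
    (hf : Function.Surjective f) {l : ℕ} {c : H} (hc : c ∈ commutatorsOfLength H l) :
    ∃ d ∈ commutatorsOfLength G l, f d = c := by
  obtain ⟨x, xs, hl, rfl⟩ := hc
  obtain ⟨x, rfl⟩ := hf x
  obtain ⟨xs, rfl⟩ := List.map_surjective_iff.2 hf xs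
  exact ⟨_, ⟨x, xs, by simpa using hl, rfl⟩, map_leftNormedCommutator f x xs⟩

theorem conj_mem_commutatorsOfLength {G : Type*} [Group G] {l : ℕ} {c : G}
    (hc : c ∈ commutatorsOfLength G l) (g : G) : g * c * g⁻¹ ∈ commutatorsOfLength G l :=
  map_mem_commutatorsOfLength (MulAut.conj g).toMonoidHom hc

theorem orderOf_conj_eq {G : Type*} [Group G] (g c : G) : orderOf (g * c * g⁻¹) = orderOf c :=
  orderOf_injective (MulAut.conj g).toMonoidHom (MulAut.conj g).injective c

theorem isOfFinOrder_conj_iff {G : Type*} [Group G] (g c : G) :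
    IsOfFinOrder (g * c * g⁻¹) ↔ IsOfFinOrder c := by
  rw [← orderOf_pos_iff, orderOf_conj_eq, orderOf_pos_iff]

theorem leftNormedCommutator_mem {G : Type*} [Group G] {H : Subgroup G} [H.Normal] {h : G}
    (hh : h ∈ H) (ys : List G) : leftNormedCommutator h ys ∈ H := by
  induction ys generalizing h with
  | nil => exact hh
  | cons y ys ih =>
    refine ih (h := elemCommutator h y) ?_
    have := H.mul_mem (H.inv_mem hh) (Subgroup.Normal.conj_mem ‹_› h hh y⁻¹)
    simpa [elemCommutator, mul_assoc] using this

/-- An initial segment of a long commutator can serve as a single first entry. -/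
theorem leftNormedCommutator_mem_commutatorsOfLength {G : Type*} [Group G] {l : ℕ} (x : G)
    (xs : List G) (hl : 1 ≤ l) (h : l ≤ xs.length + 1) :
    leftNormedCommutator x xs ∈ commutatorsOfLength G l := by
  refine ⟨leftNormedCommutator x (xs.take (xs.length + 1 - l)), xs.drop (xs.length + 1 - l),
    by simp; omega, ?_⟩
  rw [← leftNormedCommutator_append, List.take_append_drop]

theorem elemOrder_eq_top_iff {G : Type*} [Group G] (g : G) :
    elemOrder g = ⊤ ↔ ¬ IsOfFinOrder g := by
  rw [elemOrder, ENat.card_eq_top, ← not_finite_iff_infinite, ← finite_zpowers]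
  rfl

theorem elemOrder_of_isOfFinOrder {G : Type*} [Group G] {g : G} (h : IsOfFinOrder g) :
    elemOrder g = orderOf g := by
  have : Finite (Subgroup.zpowers g) := finite_zpowers.2 h
  rw [elemOrder, ← Nat.card_zpowers, ENat.card_eq_coe_natCard]

/-! ### Subgroups of finite index. -/

section FiniteIndex

theorem Subgroup.finiteIndex_of_finite_range {G α : Type*} [Group G] (H : Subgroup G) (f : G → α)
    (hf : (Set.range f).Finite) (h : ∀ a b, f a = f b → a⁻¹ * b ∈ H) : H.FiniteIndex := by
  have := hf.to_subtype
  have : Finite (G ⧸ H) := by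
    refine Finite.of_surjective (fun r : Set.range f => (r.2.choose : G ⧸ H)) fun q => ?_
    induction q using QuotientGroup.induction_on with
    | H g =>
      exact ⟨⟨f g, g, rfl⟩, QuotientGroup.eq.2 (h _ _ (Exists.choose_spec (p := fun y => f y = f g) _))⟩
  exact Subgroup.finiteIndex_of_finite_quotient

/-- Conjugation permutes the finite set `D`, and elements inducing the same permutation differ by an
element of the centralizer. -/
theorem Subgroup.finiteIndex_centralizer_of_finite {G : Type*} [Group G] {D : Set G}
    (hD : D.Finite) (hconj : ∀ d ∈ D, ∀ g : G, g * d * g⁻¹ ∈ D) :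
    (Subgroup.centralizer D).FiniteIndex := by
  have := hD.to_subtype
  refine Subgroup.finiteIndex_of_finite_range _
    (fun g (d : D) => (⟨g⁻¹ * d * g, by simpa using hconj d d.2 g⁻¹⟩ : D)) (Set.toFinite _) ?_
  intro a b hab
  rw [Subgroup.mem_centralizer_iff]
  intro d hd
  have h := congrArg Subtype.val (congrFun hab ⟨a * d * a⁻¹, hconj d hd a⟩)
  simp only [mul_assoc, inv_mul_cancel_left, inv_mul_cancel, mul_one] at h
  nth_rw 2 [h]
  simp [mul_assoc]

theorem Group.ResiduallyFinite.exists_normal_finiteIndex_le {G : Type*} [Group G]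
    [Group.ResiduallyFinite G] {S : Set G} (hS : S.Finite) (h1 : (1 : G) ∉ S) (K : Subgroup G)
    [K.FiniteIndex] : ∃ M : Subgroup G, M.Normal ∧ M.FiniteIndex ∧ M ≤ K ∧ ∀ s ∈ S, s ∉ M := by
  induction S, hS using Set.Finite.induction_on with
  | empty => exact ⟨K.normalCore, inferInstance, inferInstance, K.normalCore_le, by simp⟩
  | @insert a S _ _ ih =>
    obtain ⟨M, hM, hM', hMK, hMS⟩ := ih fun h => h1 (Set.mem_insert_of_mem _ h)
    obtain ⟨N, hN⟩ := Group.exists_finiteIndexNormalSubgroup_notMem a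
      fun h => h1 (h ▸ Set.mem_insert _ _)
    have := N.isNormal'
    have := N.isFiniteIndex'
    refine ⟨M ⊓ N.toSubgroup, inferInstance, inferInstance, inf_le_left.trans hMK, ?_⟩
    rintro s (rfl | hs) ⟨h, h'⟩
    · exact hN h'
    · exact hMS s hs h

end FiniteIndex

/-! ### Nilpotency of M from a coset identity. -/

section RelativeSeries

variable {G : Type*} [Group G]

/-- The elements that centralize `M` modulo `N`. -/
def Subgroup.centralizerMod (N M : Subgroup G) [N.Normal] : Subgroup G :=
  (Subgroup.centralizer (M.map (QuotientGroup.mk' N) : Set (G ⧸ N))).comap (QuotientGroup.mk' N)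

theorem Subgroup.mem_centralizerMod_iff {N M : Subgroup G} [N.Normal] {g : G} :
    g ∈ N.centralizerMod M ↔ ∀ m ∈ M, elemCommutator g m ∈ N := by
  rw [Subgroup.centralizerMod, Subgroup.mem_comap, Subgroup.mem_centralizer_iff]
  simp only [Subgroup.coe_map, Set.forall_mem_image, SetLike.mem_coe]
  refine forall₂_congr fun m _ => ?_
  rw [← map_mul, ← map_mul, QuotientGroup.mk'_apply, QuotientGroup.mk'_apply, QuotientGroup.eq,
    elemCommutator_eq_mul]

theorem Subgroup.mem_centralizerMod_iff_commutatorElement {N M : Subgroup G} [N.Normal] {g : G} :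
    g ∈ N.centralizerMod M ↔ ∀ m ∈ M, ⁅g, m⁆ ∈ N := by
  rw [← inv_mem_iff, Subgroup.mem_centralizerMod_iff]
  simp only [commutatorElement_eq_elemCommutator_inv]
  exact ⟨fun h m hm => h _ (M.inv_mem hm), fun h m hm => by simpa using h _ (M.inv_mem hm)⟩

instance Subgroup.centralizerMod_normal (N M : Subgroup G) [N.Normal] [M.Normal] :
    (N.centralizerMod M).Normal := by
  have := Subgroup.Normal.map ‹M.Normal› (QuotientGroup.mk' N) (QuotientGroup.mk'_surjective N)
  unfold Subgroup.centralizerMod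
  infer_instance

/-- The series `1 = T₀ ≤ T₁ ≤ …` in which `Tₖ₊₁ / Tₖ` is the centralizer of `M` in `G / Tₖ`,
bundled with normality. -/
def relUpperCentralSeriesAux (M : Subgroup G) [M.Normal] : ℕ → {T : Subgroup G // T.Normal}
  | 0 => ⟨⊥, inferInstance⟩
  | k + 1 =>
    have := (relUpperCentralSeriesAux M k).2
    ⟨(relUpperCentralSeriesAux M k).1.centralizerMod M, inferInstance⟩

/-- The series `1 = T₀ ≤ T₁ ≤ …` in which `Tₖ₊₁ / Tₖ` is the centralizer of `M` in `G / Tₖ`. -/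
def relUpperCentralSeries (M : Subgroup G) [M.Normal] (k : ℕ) : Subgroup G :=
  (relUpperCentralSeriesAux M k).1

instance (M : Subgroup G) [M.Normal] (k : ℕ) : (relUpperCentralSeries M k).Normal :=
  (relUpperCentralSeriesAux M k).2

theorem mem_relUpperCentralSeries_succ {M : Subgroup G} [M.Normal] {k : ℕ} {g : G} :
    g ∈ relUpperCentralSeries M (k + 1) ↔
      ∀ m ∈ M, elemCommutator g m ∈ relUpperCentralSeries M k :=
  Subgroup.mem_centralizerMod_iff (N := relUpperCentralSeries M k)

theorem lowerCentralSeries_le_relUpperCentralSeries (M : Subgroup G) [M.Normal] (i k : ℕ)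
    (h : M ≤ relUpperCentralSeries M (k + i)) :
    M.lowerCentralSeries i ≤ relUpperCentralSeries M k := by
  induction i generalizing k with
  | zero => exact h
  | succ i ih =>
    rw [Subgroup.lowerCentralSeries_succ, Subgroup.commutator_le]
    intro g hg m hm
    rw [commutatorElement_eq_elemCommutator_inv]
    exact mem_relUpperCentralSeries_succ.1
      (inv_mem (ih (k + 1) (by rwa [add_right_comm]) hg)) _ (inv_mem hm)

/-- As [u, xm] = [u, m]·[u, x]ᵐ, if [u, xm] and [u, x] lie in Tₖ for all m in `M`, so does [u, m],
that is, u lies in Tₖ₊₁. Each entry is removed at the cost of one index. -/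
theorem mem_relUpperCentralSeries_of_coset (M : Subgroup G) [M.Normal] (ys : List G) (y : G)
    (k : ℕ) (h : ∀ z zs, y⁻¹ * z ∈ M → List.Forall₂ (fun a b => a⁻¹ * b ∈ M) ys zs →
      leftNormedCommutator z zs ∈ relUpperCentralSeries M k) :
    M ≤ relUpperCentralSeries M (k + ys.length) := by
  induction ys using List.reverseRecOn generalizing k with
  | nil =>
    intro m hm
    have h1 := h (y * m) [] (by simpa using hm) .nil
    have h2 := h y [] (by simp) .nil
    simpa [leftNormedCommutator] using mul_mem (inv_mem h2) h1
  | append_singleton ys x ih =>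
    rw [List.length_append, List.length_singleton, add_comm ys.length, ← add_assoc]
    refine ih (k + 1) fun z zs hz hzs => ?_
    refine mem_relUpperCentralSeries_succ.2 fun m hm => ?_
    have h1 := h z (zs ++ [x * m]) hz (List.rel_append hzs (.cons (by simpa using hm) .nil))
    have h2 := h z (zs ++ [x]) hz (List.rel_append hzs (.cons (by simp) .nil))
    rw [leftNormedCommutator_concat] at h1 h2
    rw [elemCommutator_mul_right] at h1
    have h3 := Subgroup.Normal.conj_mem (H := relUpperCentralSeries M k) inferInstance _ h2 m⁻¹
    rw [inv_inv] at h3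
    exact (Subgroup.mul_mem_cancel_right _ h3).1 h1

/-- A constant value of the left-normed commutator on cosets of `M`, centralized by `M`, forces
`M` to be nilpotent. -/
theorem lowerCentralSeries_eq_bot_of_coset_identity (M : Subgroup G) [M.Normal] (y : G)
    (ys : List G) (c : G) (hc : M ≤ Subgroup.centralizer {c})
    (h : ∀ z zs, y⁻¹ * z ∈ M → List.Forall₂ (fun a b => a⁻¹ * b ∈ M) ys zs →
      leftNormedCommutator z zs = c) :
    M.lowerCentralSeries ys.length = ⊥ := by
  have key : M ≤ relUpperCentralSeries M (0 + ys.length) := by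
    rcases List.eq_nil_or_concat ys with rfl | ⟨ys, x, rfl⟩
    · intro m hm
      have h1 := h (y * m) [] (by simpa using hm) .nil
      have h2 := h y [] (by simp) .nil
      simp only [leftNormedCommutator, List.foldl_nil] at h1 h2
      have : m = 1 := by rw [h2] at h1; simpa using h1
      exact this ▸ one_mem _
    · simp only [List.concat_eq_append, List.length_append, List.length_singleton]
      rw [add_comm ys.length, ← add_assoc]
      simp only [List.concat_eq_append] at h
      -- The value `c` need not lie in the series, but `M` centralizes it, so c = [u, m]·cᵐ = [u,
      -- m]·c still gives [u, m] = 1. This puts u in T₁.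
      refine mem_relUpperCentralSeries_of_coset M ys y (0 + 1) fun z zs hz hzs =>
        mem_relUpperCentralSeries_succ.2 fun m hm => ?_
      have h1 := h z (zs ++ [x * m]) hz (List.rel_append hzs (.cons (by simpa using hm) .nil))
      have h2 := h z (zs ++ [x]) hz (List.rel_append hzs (.cons (by simp) .nil))
      rw [leftNormedCommutator_concat] at h1 h2
      have hcm := Subgroup.mem_centralizer_iff.1 (hc hm) c rfl
      rw [elemCommutator_mul_right, h2, mul_assoc, hcm, inv_mul_cancel_left] at h1
      rw [mul_eq_right] at h1
      exact h1 ▸ one_mem _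
  exact le_bot_iff.1 (lowerCentralSeries_le_relUpperCentralSeries M _ 0 key)

end RelativeSeries

/-! ### The coset identity when the maximal order is finite. -/

theorem leftNormedCommutator_congr_mod {G : Type*} [Group G] (M : Subgroup G) [M.Normal]
    {y z : G} {ys zs : List G} (h : y⁻¹ * z ∈ M)
    (hs : List.Forall₂ (fun a b => a⁻¹ * b ∈ M) ys zs) :
    (leftNormedCommutator y ys)⁻¹ * leftNormedCommutator z zs ∈ M := by
  have h' : (QuotientGroup.mk' M) y = QuotientGroup.mk' M z := QuotientGroup.eq.2 h
  have hs' : ys.map (QuotientGroup.mk' M) = zs.map (QuotientGroup.mk' M) := by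
    induction hs with
    | nil => rfl
    | cons hab _ ih => exact congrArg₂ List.cons (QuotientGroup.eq.2 hab) ih
  rw [← QuotientGroup.eq]
  change QuotientGroup.mk' M _ = QuotientGroup.mk' M _
  rw [map_leftNormedCommutator, map_leftNormedCommutator, h', hs']

theorem conj_mem_maxOrderCommutators {G : Type*} [Group G] {l : ℕ} {c : G}
    (hc : c ∈ maxOrderCommutators G l) (g : G) : g * c * g⁻¹ ∈ maxOrderCommutators G l := by
  refine ⟨conj_mem_commutatorsOfLength hc.1 g, fun d hd => (hc.2 d hd).trans_eq ?_⟩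
  by_cases h : IsOfFinOrder c
  · rw [elemOrder_of_isOfFinOrder h,
      elemOrder_of_isOfFinOrder ((isOfFinOrder_conj_iff g c).2 h)]
    exact congrArg _ (orderOf_conj_eq g c).symm
  · rw [(elemOrder_eq_top_iff _).2 h, eq_comm, elemOrder_eq_top_iff, isOfFinOrder_conj_iff]
    exact h

theorem exists_normal_finiteIndex_lowerCentralSeries_eq_bot {G : Type*} [Group G]
    [Group.ResiduallyFinite G] {l : ℕ} (hfin : (maxOrderCommutators G l).Finite) {c : G}
    (hc : c ∈ maxOrderCommutators G l) (hord : IsOfFinOrder c) :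
    ∃ M : Subgroup G, M.Normal ∧ M.FiniteIndex ∧ M.lowerCentralSeries (l - 1) = ⊥ := by
  have := Subgroup.finiteIndex_centralizer_of_finite hfin
    fun d hd g => conj_mem_maxOrderCommutators hd g
  have hz : (Subgroup.zpowers c : Set G).Finite := finite_zpowers.2 hord
  -- Avoiding the nontrivial powers of `c` makes the order of any d ≡ c mod `M` a multiple of that
  -- of `c`, so a commutator d is again of maximal order. Avoiding the nontrivial c⁻¹d then gives d
  -- = c.
  obtain ⟨M, hM, hM', hMC, hMS⟩ := Group.ResiduallyFinite.exists_normal_finiteIndex_le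
    (S := ((Subgroup.zpowers c : Set G) ∪ (fun d => c⁻¹ * d) '' maxOrderCommutators G l) \ {1})
    ((hz.union (hfin.image _)).sdiff) (by simp) (Subgroup.centralizer (maxOrderCommutators G l))
  refine ⟨M, hM, hM', ?_⟩
  obtain ⟨⟨x, xs, hl, hx⟩, hmax⟩ := id hc
  rw [show l - 1 = xs.length by omega]
  refine lowerCentralSeries_eq_bot_of_coset_identity M x xs c
    (hMC.trans (Subgroup.centralizer_le (by simpa using hc))) fun z zs hz' hzs => ?_
  have hmod := leftNormedCommutator_congr_mod M hz' hzs
  rw [hx] at hmod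
  have hd : leftNormedCommutator z zs ∈ commutatorsOfLength G l :=
    ⟨z, zs, by rw [← hzs.length_eq]; exact hl, rfl⟩
  generalize leftNormedCommutator z zs = d at hmod hd
  have hdfin : IsOfFinOrder d := by
    by_contra h
    have h' := hmax d hd
    rw [(elemOrder_eq_top_iff d).2 h, top_le_iff, elemOrder_eq_top_iff] at h'
    exact h' hord
  have hdvd : orderOf c ∣ orderOf d := by
    rw [orderOf_dvd_iff_pow_eq_one]
    by_contra hne
    refine hMS (c ^ orderOf d) ⟨Or.inl (Subgroup.npow_mem_zpowers c _), hne⟩ ?_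
    rw [← QuotientGroup.eq_one_iff, QuotientGroup.mk_pow, QuotientGroup.eq.2 hmod,
      ← QuotientGroup.mk_pow, pow_orderOf_eq_one, QuotientGroup.mk_one]
  have hdD : d ∈ maxOrderCommutators G l := by
    refine ⟨hd, fun e he => (hmax e he).trans ?_⟩
    rw [elemOrder_of_isOfFinOrder hord, elemOrder_of_isOfFinOrder hdfin]
    exact_mod_cast Nat.le_of_dvd hdfin.orderOf_pos hdvd
  by_contra hne
  refine hMS (c⁻¹ * d) ⟨Or.inr ⟨d, hdD, rfl⟩, fun h => hne ?_⟩ hmod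
  exact (inv_mul_eq_one.1 h).symm

theorem Subgroup.closure_normal_of_conj_mem {G : Type*} [Group G] {s : Set G}
    (hs : ∀ d ∈ s, ∀ g : G, g * d * g⁻¹ ∈ s) : (Subgroup.closure s).Normal := by
  have : Group.conjugatesOfSet s = s := by
    refine subset_antisymm (fun x hx => ?_) Group.subset_conjugatesOfSet
    obtain ⟨a, ha, hax⟩ := Group.mem_conjugatesOfSet_iff.1 hx
    obtain ⟨g, rfl⟩ := isConj_iff.1 hax
    exact hs a ha g
  rw [← this]
  exact Subgroup.normalClosure_normal

/-! ### Commutators of infinite order: the torsion-free abelian case. -/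

section InfiniteOrder

variable {G : Type*} [Group G]

/-- The commutators of length `l` of infinite order. -/
def infiniteOrderCommutators (G : Type*) [Group G] (l : ℕ) : Set G :=
  {c | c ∈ commutatorsOfLength G l ∧ ¬ IsOfFinOrder c}

theorem isOfFinOrder_of_forall_pow_mem {D : Set G} (hD : D.Finite) {g : G}
    (h : ∀ j : ℕ, 0 < j → g ^ j ∈ D) : IsOfFinOrder g := by
  by_contra hg
  have hinj := injective_pow_iff_not_isOfFinOrder.2 hg
  refine Set.infinite_of_injective_forall_mem (f := fun j : ℕ => g ^ (j + 1)) ?_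
    (fun j => h (j + 1) j.succ_pos) hD
  exact fun a b hab => Nat.succ_injective (hinj hab)

/-- On an abelian normal subgroup, h ↦ [h, y] is an endomorphism. -/
theorem leftNormedCommutator_pow_left {H : Subgroup G} [H.Normal]
    (hcomm : ∀ a ∈ H, ∀ b ∈ H, Commute a b) {h : G} (hh : h ∈ H) (ys : List G) (j : ℕ) :
    leftNormedCommutator (h ^ j) ys = leftNormedCommutator h ys ^ j := by
  induction ys generalizing h with
  | nil => rfl
  | cons y ys ih =>
    have key : elemCommutator (h ^ j) y = elemCommutator h y ^ j := by
      have hy : y⁻¹ * h * y ∈ H := by simpa using Subgroup.Normal.conj_mem ‹_› h hh y⁻¹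
      have e (x : G) : elemCommutator x y = x⁻¹ * (y⁻¹ * x * y) := by
        simp [elemCommutator, mul_assoc]
      have e' : y⁻¹ * h ^ j * y = (y⁻¹ * h * y) ^ j := by
        simpa using (conj_pow (i := j) (a := y⁻¹) (b := h)).symm
      rw [e, e, (hcomm _ (inv_mem hh) _ hy).mul_pow, e', inv_pow]
    change leftNormedCommutator (elemCommutator (h ^ j) y) ys =
      leftNormedCommutator (elemCommutator h y) ys ^ j
    rw [key, ih (show elemCommutator h y ∈ H from leftNormedCommutator_mem hh [y])]

theorem elemCommutator_pow_right_of_commute {w z : G} (h : ∀ g, Commute (elemCommutator w z) g)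
    (j : ℕ) : elemCommutator w (z ^ j) = elemCommutator w z ^ j := by
  have e : w⁻¹ * z⁻¹ * w = elemCommutator w z * z⁻¹ := by simp [elemCommutator]
  have e' : w⁻¹ * z⁻¹ ^ j * w = (w⁻¹ * z⁻¹ * w) ^ j := by
    simpa using (conj_pow (i := j) (a := w⁻¹) (b := z⁻¹)).symm
  rw [elemCommutator, ← inv_pow, e', e, (h z⁻¹).mul_pow, mul_assoc,
    ← (Commute.refl z).inv_left.mul_pow]
  simp

/-- An element of `H` all of whose powers are commutators of length `l` is trivial, by finiteness.
This kills [c, y₁, …, y_{l-1}], whose powers are [cʲ, y₁, …]. For the least k such that all [c, y₁,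
…, yₖ] vanish, a nontrivial [c, y₁, …, yₖ₋₁] is central, so its powers arise by raising its last
entry to powers; it must then be trivial too. -/
theorem infiniteOrderCommutators_eq_empty_of_commute {l : ℕ} (hl : 1 ≤ l)
    (hfin : (infiniteOrderCommutators G l).Finite) {H : Subgroup G} [H.Normal]
    (hcomm : ∀ a ∈ H, ∀ b ∈ H, Commute a b) (htor : ∀ h ∈ H, IsOfFinOrder h → h = 1)
    (hH : infiniteOrderCommutators G l ⊆ H) : infiniteOrderCommutators G l = ∅ := by
  refine Set.eq_empty_iff_forall_notMem.2 fun c hc => ?_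
  have hpow : ∀ h ∈ H, (∀ j : ℕ, h ^ j ∈ commutatorsOfLength G l) → h = 1 := by
    intro h hh hj
    by_contra hne
    have hinf := fun h' => hne (htor h hh h')
    exact hinf <| isOfFinOrder_of_forall_pow_mem hfin fun j hj0 =>
      ⟨hj j, fun h' => (isOfFinOrder_pow.1 h').elim hinf hj0.ne'⟩
  have hkill : ∀ ys : List G, ys.length = l - 1 → leftNormedCommutator c ys = 1 := fun ys hys =>
    hpow _ (leftNormedCommutator_mem (hH hc) ys) fun j =>
      ⟨c ^ j, ys, by omega, leftNormedCommutator_pow_left hcomm (hH hc) ys j⟩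
  have hex : ∃ k, ∀ ys : List G, ys.length = k → leftNormedCommutator c ys = 1 := ⟨_, hkill⟩
  classical
  have hspec := Nat.find_spec hex
  have hle : Nat.find hex ≤ l - 1 := Nat.find_min' hex hkill
  have hmin := fun k => Nat.find_min hex (m := k)
  generalize Nat.find hex = k at hspec hle hmin
  cases k with
  | zero =>
    refine hc.2 ?_
    have : c = 1 := hspec [] rfl
    exact this ▸ IsOfFinOrder.one
  | succ k =>
    have := hmin k k.lt_succ_self
    push Not at this
    obtain ⟨ys, hys, hne⟩ := this
    refine hne ?_
    have hcentral : ∀ g, Commute (leftNormedCommutator c ys) g := by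
      intro g
      have := hspec (ys ++ [g]) (by simp [hys])
      rw [leftNormedCommutator_concat, elemCommutator_eq_mul, inv_mul_eq_one] at this
      exact this.symm
    refine hpow _ (leftNormedCommutator_mem (hH hc) ys) fun j => ?_
    obtain ⟨⟨x, xs, hxl, rfl⟩, -⟩ := hc
    rw [← leftNormedCommutator_append] at hcentral ⊢
    -- Here k + 1 ≤ l - 1, so `xs` is nonempty and a last entry exists even when `ys` is empty.
    rcases List.eq_nil_or_concat (xs ++ ys) with h | ⟨ws, z, h⟩
    · have := congrArg List.length h
      simp only [List.length_append, List.length_nil] at this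
      omega
    · have hlen := congrArg List.length h
      simp at hlen
      rw [h, List.concat_eq_append, leftNormedCommutator_concat] at hcentral ⊢
      rw [← elemCommutator_pow_right_of_commute hcentral, ← leftNormedCommutator_concat]
      exact leftNormedCommutator_mem_commutatorsOfLength _ _ hl (by simp; omega)

end InfiniteOrder

/-! ### Torsion in center-by-finite groups, and reduction to the abelian case. -/

section Torsion

variable {H : Type*} [Group H]

/-- The torsion elements of a group whose center has finite index. -/
def centerTorsion (H : Type*) [Group H] [(Subgroup.center H).FiniteIndex] : Subgroup H where
  carrier := {h | IsOfFinOrder h}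
  one_mem' := IsOfFinOrder.one
  mul_mem' := by
    intro a b ha hb
    -- The transfer into the center is a homomorphism to an abelian group given by raising to the
    -- power of the index, so it detects torsion.
    have h : IsOfFinOrder (MonoidHom.transferCenterPow H (a * b)) := by
      rw [map_mul]
      exact Commute.isOfFinOrder_mul (Subtype.ext (Subgroup.mem_center_iff.1 (Subtype.property _) _))
        (MonoidHom.isOfFinOrder _ ha) (MonoidHom.isOfFinOrder _ hb)
    replace h := (Subgroup.center H).subtype.isOfFinOrder h
    rw [Subgroup.subtype_apply, MonoidHom.transferCenterPow_apply, isOfFinOrder_pow,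
      or_iff_left Subgroup.FiniteIndex.index_ne_zero] at h
    exact h
  inv_mem' := IsOfFinOrder.inv

theorem mem_centerTorsion_iff [(Subgroup.center H).FiniteIndex] {h : H} :
    h ∈ centerTorsion H ↔ IsOfFinOrder h :=
  Iff.rfl

theorem isOfFinOrder_commutatorElement [(Subgroup.center H).FiniteIndex] (a b : H) :
    IsOfFinOrder ⁅a, b⁆ := by
  have h : MonoidHom.transferCenterPow H ⁅a, b⁆ = 1 := by
    rw [map_commutatorElement, commutatorElement_eq_one_iff_commute]
    exact Subtype.ext (Subgroup.mem_center_iff.1 (Subtype.property _) _)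
  replace h := congrArg Subtype.val h
  rw [MonoidHom.transferCenterPow_apply] at h
  exact isOfFinOrder_iff_pow_eq_one.2
    ⟨_, Nat.pos_of_ne_zero Subgroup.FiniteIndex.index_ne_zero, h⟩

end Torsion

/-- Factoring out the torsion `T` of `H` makes `H` abelian and torsion-free, while elements of `H`
of infinite order keep infinite order. -/
theorem infiniteOrderCommutators_eq_empty {G : Type*} [Group G] {l : ℕ} (hl : 1 ≤ l)
    (hfin : (infiniteOrderCommutators G l).Finite) : infiniteOrderCommutators G l = ∅ := by
  have hconj : ∀ d ∈ infiniteOrderCommutators G l, ∀ g : G,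
      g * d * g⁻¹ ∈ infiniteOrderCommutators G l := fun d hd g =>
    ⟨conj_mem_commutatorsOfLength hd.1 g, by rw [isOfFinOrder_conj_iff]; exact hd.2⟩
  have hC := Subgroup.finiteIndex_centralizer_of_finite hfin hconj
  set H := Subgroup.closure (infiniteOrderCommutators G l) with hH
  have hHn : H.Normal := Subgroup.closure_normal_of_conj_mem hconj
  have hcen : (Subgroup.center H).FiniteIndex := by
    refine Subgroup.finiteIndex_of_le (H := (Subgroup.centralizer
      (infiniteOrderCommutators G l)).subgroupOf H) fun h hh => Subgroup.mem_center_iff.2 fun g => ?_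
    rw [Subgroup.mem_subgroupOf, ← Subgroup.centralizer_closure, Subgroup.mem_centralizer_iff] at hh
    exact Subtype.ext (hh g g.2)
  set T := (centerTorsion H).map H.subtype with hT
  have hTmem : ∀ g, g ∈ T ↔ g ∈ H ∧ IsOfFinOrder g := by
    intro g
    rw [hT, Subgroup.mem_map]
    constructor
    · rintro ⟨h, hh, rfl⟩
      exact ⟨h.2, H.subtype.isOfFinOrder (mem_centerTorsion_iff.1 hh)⟩
    · rintro ⟨hg, hg'⟩
      exact ⟨⟨g, hg⟩, mem_centerTorsion_iff.2 (Submonoid.isOfFinOrder_coe.1 hg'), rfl⟩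
  have hTn : T.Normal := ⟨fun t ht g => (hTmem _).2 ⟨hHn.conj_mem t ((hTmem t).1 ht).1 g,
    (isOfFinOrder_conj_iff g t).2 ((hTmem t).1 ht).2⟩⟩
  have hmk : ∀ h ∈ H, IsOfFinOrder (QuotientGroup.mk' T h) → h ∈ T := by
    intro h hh ho
    obtain ⟨n, hn, hn'⟩ := isOfFinOrder_iff_pow_eq_one.1 ho
    rw [← map_pow, QuotientGroup.mk'_apply, QuotientGroup.eq_one_iff, hTmem, isOfFinOrder_pow,
      or_iff_left hn.ne'] at hn'
    exact (hTmem h).2 ⟨hh, hn'.2⟩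
  have hsub : infiniteOrderCommutators (G ⧸ T) l ⊆
      QuotientGroup.mk' T '' infiniteOrderCommutators G l := by
    rintro q ⟨hq, hq'⟩
    obtain ⟨d, hd, rfl⟩ := exists_lift_mem_commutatorsOfLength (QuotientGroup.mk' T)
      (QuotientGroup.mk'_surjective T) hq
    exact ⟨d, ⟨hd, fun h => hq' (MonoidHom.isOfFinOrder _ h)⟩, rfl⟩
  have hn' : (H.map (QuotientGroup.mk' T)).Normal :=
    hHn.map _ (QuotientGroup.mk'_surjective T)
  have hempty := infiniteOrderCommutators_eq_empty_of_commute (G := G ⧸ T) hl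
    ((hfin.image _).subset hsub) (H := H.map (QuotientGroup.mk' T)) ?_ ?_
    (hsub.trans (Set.image_mono Subgroup.subset_closure))
  · refine Set.eq_empty_iff_forall_notMem.2 fun c hc => ?_
    have hc' : QuotientGroup.mk' T c ∈ infiniteOrderCommutators (G ⧸ T) l :=
      ⟨map_mem_commutatorsOfLength _ hc.1, fun h =>
        hc.2 ((hTmem c).1 (hmk c (Subgroup.subset_closure hc) h)).2⟩
    rw [hempty] at hc'
    exact hc'
  · rintro _ ⟨a, ha, rfl⟩ _ ⟨b, hb, rfl⟩
    rw [← commutatorElement_eq_one_iff_commute, ← map_commutatorElement, QuotientGroup.mk'_apply,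
      QuotientGroup.eq_one_iff]
    have := isOfFinOrder_commutatorElement (⟨a, ha⟩ : H) ⟨b, hb⟩
    exact (hTmem _).2 ⟨(⁅(⟨a, ha⟩ : H), ⟨b, hb⟩⁆ : H).2, H.subtype.isOfFinOrder this⟩
  · rintro _ ⟨h, hh, rfl⟩ ho
    exact (QuotientGroup.eq_one_iff h).2 (hmk h hh ho)

/-! ### Generators of the lower central series and torsion of nilpotent groups. -/

section LowerCentralSeries

variable {G : Type*} [Group G]

/-- A normal subgroup containing the commutators of elements of `S` with generators of `G`
contains `⁅closure S, G⁆`. -/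
theorem Subgroup.commutator_top_le_of_closure {N : Subgroup G} [N.Normal] {S B : Set G}
    (hB : Subgroup.closure B = ⊤) (h : ∀ s ∈ S, ∀ b ∈ B, elemCommutator s b ∈ N) :
    ⁅Subgroup.closure S, (⊤ : Subgroup G)⁆ ≤ N := by
  have key : Subgroup.closure S ≤ N.centralizerMod ⊤ := by
    refine (Subgroup.closure_le _).2 fun s hs => ?_
    refine Subgroup.mem_centralizerMod_iff.2 fun m _ => ?_
    have hm : m ∈ Subgroup.closure B := hB ▸ Subgroup.mem_top m
    have hle : Subgroup.closure B ≤
        (Subgroup.centralizer {QuotientGroup.mk' N s}).comap (QuotientGroup.mk' N) := by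
      refine (Subgroup.closure_le _).2 fun b hb => ?_
      rw [SetLike.mem_coe, Subgroup.mem_comap, Subgroup.mem_centralizer_iff]
      rintro _ rfl
      have := h s hs b hb
      rw [elemCommutator_eq_mul] at this
      exact (QuotientGroup.eq.2 this).symm
    have := Subgroup.mem_centralizer_iff.1 (hle hm) _ rfl
    rw [elemCommutator_eq_mul]
    exact QuotientGroup.eq.1 this.symm
  refine Subgroup.commutator_le.2 fun g hg m hm => ?_
  exact Subgroup.mem_centralizerMod_iff_commutatorElement.1 (key hg) m hm

theorem lowerCentralSeries_eq_closure (i : ℕ) :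
    (⊤ : Subgroup G).lowerCentralSeries i = Subgroup.closure (commutatorsOfLength G (i + 1)) := by
  induction i with
  | zero =>
    have : commutatorsOfLength G 1 = Set.univ :=
      Set.eq_univ_of_forall fun g => ⟨g, [], rfl, rfl⟩
    rw [zero_add, this, Subgroup.closure_univ, Subgroup.lowerCentralSeries_zero]
  | succ i ih =>
    have := Subgroup.closure_normal_of_conj_mem (s := commutatorsOfLength G (i + 1 + 1))
      fun d hd g => conj_mem_commutatorsOfLength hd g
    refine le_antisymm ?_ ((Subgroup.closure_le _).2 ?_)
    · rw [Subgroup.lowerCentralSeries_succ, ih]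
      refine Subgroup.commutator_top_le_of_closure Subgroup.closure_univ ?_
      rintro _ ⟨x, xs, hxs, rfl⟩ b -
      refine Subgroup.subset_closure ⟨x, xs ++ [b], by simp [hxs], ?_⟩
      rw [leftNormedCommutator_concat]
    · rintro _ ⟨x, xs, hxs, rfl⟩
      rcases List.eq_nil_or_concat xs with rfl | ⟨xs, y, rfl⟩
      · simp at hxs
      · rw [List.concat_eq_append, leftNormedCommutator_concat, SetLike.mem_coe,
          ← inv_inv (leftNormedCommutator x xs), ← inv_inv y,
          ← commutatorElement_eq_elemCommutator_inv, Subgroup.lowerCentralSeries_succ, ih]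
        refine Subgroup.commutator_mem_commutator (inv_mem (Subgroup.subset_closure ?_)) trivial
        exact ⟨x, xs, by simpa using hxs, rfl⟩

/-- Generators of one factor, commuted with generators of `G`, generate the next factor. For
nilpotent `G` the last nontrivial term is thus finitely generated. -/
theorem exists_finite_closure_sup_lowerCentralSeries [Group.FG G] (i : ℕ) :
    ∃ S : Set G, S.Finite ∧ (⊤ : Subgroup G).lowerCentralSeries i =
      Subgroup.closure S ⊔ (⊤ : Subgroup G).lowerCentralSeries (i + 1) := by
  obtain ⟨B, hB, hBfin⟩ := Group.fg_iff.1 ‹Group.FG G›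
  induction i with
  | zero =>
    exact ⟨B, hBfin, by rw [hB, top_sup_eq, Subgroup.lowerCentralSeries_zero]⟩
  | succ i ih =>
    obtain ⟨S, hS, hSi⟩ := ih
    refine ⟨Set.image2 elemCommutator S B, hS.image2 _ hBfin, ?_⟩
    have hle : Subgroup.closure (Set.image2 elemCommutator S B) ≤
        (⊤ : Subgroup G).lowerCentralSeries (i + 1) := by
      refine (Subgroup.closure_le _).2 ?_
      rintro _ ⟨s, hs, b, -, rfl⟩
      rw [SetLike.mem_coe, ← inv_inv s, ← inv_inv b, ← commutatorElement_eq_elemCommutator_inv]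
      refine Subgroup.commutator_mem_commutator (inv_mem ?_) trivial
      rw [hSi]
      exact Subgroup.mem_sup_left (Subgroup.subset_closure hs)
    refine le_antisymm ?_ (sup_le hle (Subgroup.lowerCentralSeries_antitone _ (Nat.le_succ _)))
    set N := Subgroup.closure (Set.image2 elemCommutator S B) ⊔
      (⊤ : Subgroup G).lowerCentralSeries (i + 1 + 1) with hN
    have hNle : N ≤ (⊤ : Subgroup G).lowerCentralSeries (i + 1) :=
      sup_le hle (Subgroup.lowerCentralSeries_antitone _ (Nat.le_succ _))
    -- Any subgroup between consecutive terms of the series is normal.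
    have hNn : N.Normal := by
      refine ⟨fun n hn g => ?_⟩
      have h1 : ⁅n, g⁆ ∈ N := Subgroup.mem_sup_right
        (Subgroup.commutator_mem_commutator (hNle hn) trivial)
      have h2 : g * n * g⁻¹ = ⁅n, g⁆⁻¹ * n := by simp [commutatorElement_def, mul_assoc]
      rw [h2]
      exact mul_mem (inv_mem h1) hn
    rw [Subgroup.lowerCentralSeries_succ, hSi,
      ← Subgroup.closure_eq ((⊤ : Subgroup G).lowerCentralSeries (i + 1)),
      ← Subgroup.closure_union]
    refine Subgroup.commutator_top_le_of_closure hB ?_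
    rintro s (hs | hs) b hb
    · exact Subgroup.mem_sup_left (Subgroup.subset_closure ⟨s, hs, b, hb, rfl⟩)
    · rw [← inv_inv s, ← inv_inv b, ← commutatorElement_eq_elemCommutator_inv]
      exact Subgroup.mem_sup_right (Subgroup.commutator_mem_commutator (inv_mem hs) trivial)

end LowerCentralSeries

theorem CommGroup.finite_setOf_isOfFinOrder {A : Type*} [CommGroup A] [Group.FG A] :
    {a : A | IsOfFinOrder a}.Finite := by
  have hfg : Module.Finite ℤ (Additive A) :=
    Module.Finite.iff_addGroup_fg.2 (GroupFG.iff_add_fg.1 ‹_›)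
  have hfin := Module.finite_of_fg_torsion (Submodule.torsion ℤ (Additive A))
    (Submodule.torsion_isTorsion)
  refine (Set.toFinite ((Submodule.torsion ℤ (Additive A) : Set (Additive A)))).subset ?_
  intro (a : A) (ha : IsOfFinOrder a)
  obtain ⟨n, hn, hn'⟩ := isOfFinOrder_iff_pow_eq_one.1 ha
  exact (Submodule.mem_torsion_iff _).2
    ⟨⟨n, mem_nonZeroDivisors_of_ne_zero (by exact_mod_cast hn.ne')⟩, by
      change (n : ℤ) • Additive.ofMul a = 0
      rw [natCast_zsmul, ← ofMul_pow, hn', ofMul_one]⟩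

theorem finite_setOf_isOfFinOrder_of_lowerCentralSeries_eq_bot (i : ℕ) (G : Type*) [Group G]
    [Group.FG G] (h : (⊤ : Subgroup G).lowerCentralSeries i = ⊥) :
    {g : G | IsOfFinOrder g}.Finite := by
  induction i generalizing G with
  | zero =>
    have : Subsingleton G := Subgroup.subsingleton_iff.1 (subsingleton_of_bot_eq_top h.symm)
    exact Set.toFinite _
  | succ i ih =>
    set L := (⊤ : Subgroup G).lowerCentralSeries i with hL
    have hLc : L ≤ Subgroup.center G :=
      Subgroup.commutator_top_right_eq_bot_iff_le_center.1 h
    have hLfg : Group.FG L := by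
      obtain ⟨S, hS, hSi⟩ := exists_finite_closure_sup_lowerCentralSeries (G := G) i
      rw [h, sup_bot_eq] at hSi
      exact (Group.fg_iff_subgroup_fg L).2 ((Subgroup.fg_iff L).2 ⟨S, hSi.symm, hS⟩)
    have hq := ih (G ⧸ L) (by
      rw [← (QuotientGroup.mk' L).range_eq_top.2 (QuotientGroup.mk'_surjective L),
        MonoidHom.range_eq_map, ← Subgroup.map_lowerCentralSeries, ← hL]
      exact QuotientGroup.map_mk'_self L)
    have hLtor : {a : L | IsOfFinOrder a}.Finite := by
      let _ : CommGroup L :=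
        { mul_comm := fun a b => Subtype.ext (Subgroup.mem_center_iff.1 (hLc b.2) a) }
      exact CommGroup.finite_setOf_isOfFinOrder
    refine Set.Finite.of_finite_fibers (QuotientGroup.mk' L) (hq.subset ?_) ?_
    · rintro _ ⟨g, hg, rfl⟩
      exact MonoidHom.isOfFinOrder _ hg
    · rintro _ ⟨g, hg, rfl⟩
      -- Torsion elements g, t of one coset of the central `L` commute, so g⁻¹t is one of the
      -- finitely many torsion elements of `L`.
      refine ((hLtor.image fun a : L => g * a)).subset ?_
      rintro t ⟨ht, htg⟩
      have hmem : g⁻¹ * t ∈ L := QuotientGroup.eq.1 htg.symm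
      refine ⟨⟨g⁻¹ * t, hmem⟩, Submonoid.isOfFinOrder_coe.1 ?_, by simp⟩
      refine Commute.isOfFinOrder_mul ?_ (IsOfFinOrder.inv hg) ht
      have := Subgroup.mem_center_iff.1 (hLc hmem) g⁻¹
      rw [mul_assoc, mul_right_inj] at this
      exact this

/-! ### The upper central series and finiteness of γ_l(G). -/

section UpperCentralSeries

theorem mem_upperCentralSeries_of_leftNormedCommutator_eq_one {G : Type*} [Group G] {k : ℕ}
    {m : G} (h : ∀ ys : List G, ys.length = k → leftNormedCommutator m ys = 1) :
    m ∈ Subgroup.upperCentralSeries G k := by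
  induction k generalizing m with
  | zero => exact h [] rfl
  | succ k ih =>
    rw [← inv_mem_iff, Subgroup.mem_upperCentralSeries_succ_iff]
    intro y
    rw [commutatorElement_eq_elemCommutator_inv, inv_inv]
    exact ih fun ys hys => h (y⁻¹ :: ys) (by simp [hys])

/-- Three subgroups lemma; the induction hypothesis is used in `G` for one rotation and in G/Z(G)
for the other. -/
theorem commutator_lowerCentralSeries_upperCentralSeries_eq_bot (i : ℕ) (G : Type*) [Group G] :
    ⁅(⊤ : Subgroup G).lowerCentralSeries i, Subgroup.upperCentralSeries G (i + 1)⁆ = ⊥ := by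
  induction i generalizing G with
  | zero => simp
  | succ i ih =>
    have hcen : ⁅(⊤ : Subgroup G).lowerCentralSeries i, Subgroup.upperCentralSeries G (i + 1 + 1)⁆ ≤
        Subgroup.center G := by
      refine Subgroup.commutator_le.2 fun a ha b hb => ?_
      rw [← QuotientGroup.eq_one_iff, ← QuotientGroup.mk'_apply, map_commutatorElement]
      refine (Subgroup.mem_bot).1 ?_
      rw [← ih (G ⧸ Subgroup.center G)]
      refine Subgroup.commutator_mem_commutator ?_ ?_
      · rw [← (QuotientGroup.mk' (Subgroup.center G)).range_eq_top.2
          (QuotientGroup.mk'_surjective _), MonoidHom.range_eq_map, ← Subgroup.map_lowerCentralSeries]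
        exact Subgroup.mem_map_of_mem _ ha
      · rw [← Subgroup.mem_comap, Subgroup.comap_upperCentralSeries_quotient_center]
        exact hb
    rw [Subgroup.lowerCentralSeries_succ]
    refine Subgroup.commutator_commutator_eq_bot_of_rotate ?_ ?_
    · rw [eq_bot_iff, ← ih G, Subgroup.commutator_comm]
      refine Subgroup.commutator_mono le_rfl ?_
      rw [Subgroup.commutator_comm]
      exact Subgroup.commutator_upperCentralSeries_top_le G _
    · rw [Subgroup.commutator_top_right_eq_bot_iff_le_center, Subgroup.commutator_comm]
      exact hcen

end UpperCentralSeries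

theorem finite_lowerCentralSeries_of_isOfFinOrder {G : Type*} [Group G] [Group.FG G]
    [Group.ResiduallyFinite G] {l : ℕ} (hl : 1 ≤ l)
    (htor : ∀ c ∈ commutatorsOfLength G l, IsOfFinOrder c) {M : Subgroup G} [M.FiniteIndex]
    (hM : M.lowerCentralSeries (l - 1) = ⊥) :
    Finite ((⊤ : Subgroup G).lowerCentralSeries (l - 1)) := by
  have hMtor := finite_setOf_isOfFinOrder_of_lowerCentralSeries_eq_bot (l - 1) M (by
    rw [← Subgroup.map_subtype_inj, Subgroup.top_subtype_lowerCentralSeries, hM, Subgroup.map_bot])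
  obtain ⟨N, hN, hN', hNM, hNtor⟩ := Group.ResiduallyFinite.exists_normal_finiteIndex_le
    ((hMtor.image Subtype.val).sdiff (t := {1})) (by simp) M
  have hN1 : ∀ g ∈ N, IsOfFinOrder g → g = 1 := fun g hg ho => by
    by_contra hne
    exact hNtor g ⟨⟨⟨g, hNM hg⟩, Submonoid.isOfFinOrder_coe.1 ho, rfl⟩, hne⟩ hg
  have hNU : N ≤ Subgroup.upperCentralSeries G (l - 1 + 1) := fun m hm =>
    Subgroup.upperCentralSeries_mono G (Nat.le_succ _)
      (mem_upperCentralSeries_of_leftNormedCommutator_eq_one fun ys hys =>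
        hN1 _ (leftNormedCommutator_mem hm ys) (htor _ ⟨m, ys, by omega, rfl⟩))
  set K := (⊤ : Subgroup G).lowerCentralSeries (l - 1) with hK
  have hcen : (Subgroup.center K).FiniteIndex := by
    refine Subgroup.finiteIndex_of_le (H := N.subgroupOf K) fun h hh =>
      Subgroup.mem_center_iff.2 fun g => Subtype.ext ?_
    have := Subgroup.commutator_mem_commutator g.2 (hNU (Subgroup.mem_subgroupOf.1 hh))
    rw [commutator_lowerCentralSeries_upperCentralSeries_eq_bot, Subgroup.mem_bot,
      commutatorElement_eq_one_iff_mul_comm] at this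
    exact this
  have hKtor : ∀ g ∈ K, IsOfFinOrder g := by
    have hle : K ≤ (centerTorsion K).map K.subtype := by
      have hKc : K = Subgroup.closure (commutatorsOfLength G (l - 1 + 1)) :=
        lowerCentralSeries_eq_closure _
      rw [Nat.sub_add_cancel hl] at hKc
      refine hKc.trans_le ((Subgroup.closure_le _).2 fun c hc => ?_)
      have hcK : c ∈ K := hKc ▸ Subgroup.subset_closure hc
      exact ⟨⟨c, hcK⟩, mem_centerTorsion_iff.2 (Submonoid.isOfFinOrder_coe.1 (htor c hc)), rfl⟩
    intro g hg
    obtain ⟨h, hh, rfl⟩ := hle hg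
    exact K.subtype.isOfFinOrder (mem_centerTorsion_iff.1 hh)
  refine Finite.of_injective (fun g : K => (g : G ⧸ N)) fun a b hab => ?_
  have := hN1 _ (QuotientGroup.eq.1 hab) (hKtor _ (mul_mem (inv_mem a.2) b.2))
  exact Subtype.ext (inv_mul_eq_one.1 this)

theorem theorem1p1 {G : Type*} [Group G] (hres : Group.ResiduallyFinite G)
    (l : ℕ) (hl : 1 ≤ l)
    (hne : (maxOrderCommutators G l).Nonempty)
    (hfin : (maxOrderCommutators G l).Finite) :
    (∃ M : Subgroup G, M.FiniteIndex ∧ M.lowerCentralSeries (l - 1) = ⊥) ∧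
      (Group.FG G → Finite ((⊤ : Subgroup G).lowerCentralSeries (l - 1))) := by
  obtain ⟨c, hc⟩ := hne
  have hord : IsOfFinOrder c := by
    by_contra hinf
    -- An infinite order is automatically maximal, so finiteness passes to all commutators of
    -- infinite order.
    have heq : infiniteOrderCommutators G l ⊆ maxOrderCommutators G l := fun d hd =>
      ⟨hd.1, fun e _ => by rw [(elemOrder_eq_top_iff d).2 hd.2]; exact le_top⟩
    have hmem : c ∈ infiniteOrderCommutators G l := ⟨hc.1, hinf⟩
    rw [infiniteOrderCommutators_eq_empty hl (hfin.subset heq)] at hmem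
    exact hmem
  have htor : ∀ d ∈ commutatorsOfLength G l, IsOfFinOrder d := fun d hd => by
    by_contra h
    have h' := hc.2 d hd
    rw [(elemOrder_eq_top_iff d).2 h, top_le_iff, elemOrder_eq_top_iff] at h'
    exact h' hord
  obtain ⟨M, -, hMfin, hM⟩ := exists_normal_finiteIndex_lowerCentralSeries_eq_bot hfin hc hord
  exact ⟨⟨M, hMfin, hM⟩, fun _ => finite_lowerCentralSeries_of_isOfFinOrder hl htor hM⟩
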